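/- Fix an additively optimal (universal) prefix machine $U$, and let $K(w\mid y)$ denote the length of the shortest program with which $U$, given the side information $y$, prints the binary string $w$ and halts. For a vector $u\in[0,1]^n$, $K(u\mid n,m)$ is the least $K(w\mid n,m)$ over the binary strings $w$ that are the concatenation of finite binary expansions, of a common length, of the coordinates of $u$ ($\infty$ if there is none). For $x\in[0,1]^n$ and an integer $m\ge 1$ let \[ K^{[\cdot]_m}(x)=\inf_{u\in[0,1]^n}\bigl\{K(u\mid n,m)\;:\;\|x-u\|_\infty\le 2^{-m}\bigr\},\qquad \kappa_{m,n}(x)=\frac{K^{[\cdot]_m}(x)}{m}. \] Let $n\ge 2$, let $x_o\in[0,1]^n$ be a fixed vector, and set $m=\lceil\log_2 n\rceil$, $\kappa_n=\kappa_{m,n}(x_o)$ and $d=\lceil\kappa_n\log_2 n\rceil$. Assume that $d\le n$. Let $A$ be a random $d\times n$ matrix with i.i.d. $\mathcal N(0,1)$ entries, let $y_o=Ax_o$, and let $\hat x_o$ be a solution of minimum complexity pursuit (MCP), i.e. any minimizer of $K^{[\cdot]_m}(x)$ over all $x\in[0,1]^n$ with $Ax=y_o$. Then \[ \mathbb P\Bigl(\|x_o-\hat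 x_o\|_2>\frac{20}{\sqrt d}\Bigr)<2e^{-d/2}. \] -/

import Mathlib

open MeasureTheory ProbabilityTheory

/-- A (conditional) prefix machine: a partial computable function which takes a program and a
side-information string to an output string, and whose set of halting programs is prefix-free
for every fixed side information. -/
structure IsPrefixMachine (T : List Bool → List Bool →. List Bool) : Prop where
  partrec : Partrec₂ T
  prefix_free : ∀ y p q : List Bool, (T p y).Dom → (T q y).Dom → p <+: q → p = q

/-- `condK T x y` is the complexity `K_T(x | y)`: the least length of a program which makes the
machine `T`, with side information `y`, print `x` and halt (`⊤` if there is none). -/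
noncomputable def condK (T : List Bool → List Bool →. List Bool) (x y : List Bool) : ℕ∞ :=
  ⨅ (p : List Bool) (_ : x ∈ T p y), (p.length : ℕ∞)

/-- An additively optimal prefix machine. -/
structure IsOptimalPrefixMachine (U : List Bool → List Bool →. List Bool) : Prop where
  isPrefixMachine : IsPrefixMachine U
  optimal : ∀ T : List Bool → List Bool →. List Bool, IsPrefixMachine T →
    ∃ c : ℕ, ∀ x y : List Bool, condK U x y ≤ condK T x y + c

/-- The string `w` is the concatenation of the finite binary expansions, of a common length
`L ≥ 1`, of the coordinates of the vector `u`. -/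
def IsBinaryExpansion {n : ℕ} (u : Fin n → ℝ) (w : List Bool) : Prop :=
  ∃ L : ℕ, 0 < L ∧ ∃ b : Fin n → Fin L → Bool,
    w = (List.ofFn fun i => List.ofFn (b i)).flatten ∧
    ∀ i, u i = ∑ j : Fin L, if b i j then (2 : ℝ)⁻¹ ^ ((j : ℕ) + 1) else 0

/-- The side information `(n, m)` as a binary string. -/
def sideInfo (n m : ℕ) : List Bool := Computability.encodeNat (Nat.pair n m)

/-- `vecK U m u` is `K(u | n, m)` for a real vector `u` of length `n`
(`⊤` if `u` has no finite binary expansion). -/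
noncomputable def vecK (U : List Bool → List Bool →. List Bool) (m : ℕ) {n : ℕ}
    (u : Fin n → ℝ) : ℕ∞ :=
  ⨅ (w : List Bool) (_ : IsBinaryExpansion u w), condK U w (sideInfo n m)

/-- The Kolmogorov complexity of `x ∈ [0,1]^n` at resolution `m`: the infimum of `K(u | n, m)`
over the `u ∈ [0,1]^n` with `‖x - u‖_∞ ≤ 2^{-m}`. -/
noncomputable def resK (U : List Bool → List Bool →. List Bool) (m : ℕ) {n : ℕ}
    (x : Fin n → ℝ) : ℕ∞ :=
  ⨅ (u : Fin n → ℝ) (_ : u ∈ Set.Icc (0 : Fin n → ℝ) 1)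
    (_ : ∀ i, |x i - u i| ≤ (2 : ℝ)⁻¹ ^ m), vecK U m u

/-- The Kolmogorov information dimension `κ_{m,n}(x)` of `x ∈ [0,1]^n` at resolution `m`.
For an optimal machine, `m ≥ 1` and `x ∈ [0,1]^n`, the complexity `resK U m x` is finite
(`resK_ne_top` below), so that no value is lost in `ENat.toNat`. -/
noncomputable def kid (U : List Bool → List Bool →. List Bool) (m : ℕ) {n : ℕ}
    (x : Fin n → ℝ) : ℝ :=
  ((resK U m x).toNat : ℝ) / m

/-- `xhat` is a solution of minimum complexity pursuit at resolution `m` for the measurement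
matrix `A` and the measurements `y`: it minimizes the complexity at resolution `m` among the
`x ∈ [0,1]^n` with `A x = y`. -/
def IsMCPSolution (U : List Bool → List Bool →. List Bool) (m : ℕ) {n d : ℕ}
    (A : Matrix (Fin d) (Fin n) ℝ) (y : Fin d → ℝ) (xhat : Fin n → ℝ) : Prop :=
  xhat ∈ Set.Icc (0 : Fin n → ℝ) 1 ∧ A.mulVec xhat = y ∧
    ∀ x ∈ Set.Icc (0 : Fin n → ℝ) 1, A.mulVec x = y → resK U m xhat ≤ resK U m x

/-- Every string has finite complexity with respect to an optimal machine. -/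
theorem condK_ne_top {U : List Bool → List Bool →. List Bool} (hU : IsOptimalPrefixMachine U)
    (x y : List Bool) : condK U x y ≠ ⊤ := by
  classical
  let f : List Bool → Option (List Bool) := fun p =>
    if p = List.replicate (p.length - 1) true ++ [false] then
      Encodable.decode (p.length - 1) else none
  let T : List Bool → List Bool →. List Bool := fun p _ => (f p : Part (List Bool))
  have hrep : Primrec fun k : ℕ => List.replicate k true := by
    have : Primrec fun k : ℕ => (List.range k).map fun _ => true :=
      Primrec.list_map Primrec.list_range (Primrec.const true).to₂
    refine this.of_eq fun k => ?_
    simp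
  have hpred : Primrec fun p : List Bool => p.length - 1 :=
    Primrec.nat_sub.comp Primrec.list_length (Primrec.const 1)
  have hf : Primrec f := by
    refine Primrec.ite ?_ ?_ (Primrec.const none)
    · exact Primrec.eq.comp Primrec.id
        (Primrec.list_append.comp (hrep.comp hpred) (Primrec.const [false]))
    · exact Primrec.decode.comp hpred
  have hdom : ∀ p y, (T p y).Dom → p = List.replicate (p.length - 1) true ++ [false] := by
    intro p y h
    by_contra hne
    simp [T, f, if_neg hne] at h
  have hT : IsPrefixMachine T := by
    refine ⟨?_, ?_⟩
    · exact (Computable.ofOption (hf.to_comp.comp Computable.fst))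
    · intro y p q hp hq hpq
      have hp' := hdom p y hp
      have hq' := hdom q y hq
      have hlen := hpq.length_le
      have hppos : 0 < p.length := by rw [hp']; simp
      have hqpos : 0 < q.length := by rw [hq']; simp
      refine hpq.eq_of_length ?_
      by_contra hne
      have hlt : p.length < q.length := lt_of_le_of_ne hlen hne
      have h1 : p[p.length - 1]? = some false := by
        conv_lhs => rw [hp']
        simp
      have h2 : q[p.length - 1]? = some false := by
        rw [← h1]
        obtain ⟨r, rfl⟩ := hpq
        rw [List.getElem?_append_left (by omega)]
      have h3 : q[p.length - 1]? = some true := by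
        rw [hq', List.getElem?_append_left (by simp; omega), List.getElem?_replicate]
        simp; omega
      rw [h2] at h3
      simp at h3
  obtain ⟨c, hc⟩ := hU.optimal T hT
  refine ne_top_of_le_ne_top ?_ (hc x y)
  have hmem : x ∈ T (List.replicate (Encodable.encode x) true ++ [false]) y := by
    simp [T, f]
  have hle : condK T x y ≤ ((List.replicate (Encodable.encode x) true ++ [false]).length : ℕ∞) :=
    iInf₂_le (f := fun (p : List Bool) (_ : x ∈ T p y) => (p.length : ℕ∞)) _ hmem
  have : condK T x y ≠ ⊤ := ne_top_of_le_ne_top (ENat.natCast_ne_top _) hle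
  exact WithTop.add_ne_top.2 ⟨this, ENat.natCast_ne_top c⟩

/-- Every number in `[0,1]` has an `m`-bit binary approximation with error at most `2^{-m}`. -/
theorem exists_binary_approx (m : ℕ) : ∀ x : ℝ, 0 ≤ x → x ≤ 1 → ∃ b : Fin m → Bool,
    0 ≤ x - (∑ j : Fin m, if b j then (2 : ℝ)⁻¹ ^ ((j : ℕ) + 1) else 0) ∧
    x - (∑ j : Fin m, if b j then (2 : ℝ)⁻¹ ^ ((j : ℕ) + 1) else 0) ≤ (2 : ℝ)⁻¹ ^ m := by
  induction m with
  | zero => intro x h0 h1; exact ⟨fun _ => false, by simpa using h0, by simpa using h1⟩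
  | succ m ih =>
    intro x h0 h1
    have key : ∀ (a : Bool) (b : Fin m → Bool),
        (∑ j : Fin (m + 1), if (Fin.cons a b : Fin (m + 1) → Bool) j then
          (2 : ℝ)⁻¹ ^ ((j : ℕ) + 1) else 0) = (if a then (2 : ℝ)⁻¹ else 0) +
          (2 : ℝ)⁻¹ * ∑ j : Fin m, if b j then (2 : ℝ)⁻¹ ^ ((j : ℕ) + 1) else 0 := by
      intro a b
      rw [Fin.sum_univ_succ, Finset.mul_sum]
      congr 1
      · simp
      · refine Finset.sum_congr rfl fun j _ => ?_
        simp only [Fin.cons_succ, Fin.val_succ]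
        split_ifs
        · ring
        · simp
    rcases lt_or_ge x (1 / 2) with hx | hx
    · obtain ⟨b, hb0, hb1⟩ := ih (2 * x) (by linarith) (by linarith)
      refine ⟨Fin.cons false b, ?_, ?_⟩ <;> rw [key] <;> simp only [Bool.false_eq_true, if_false]
      · linarith
      · rw [pow_succ]; linarith
    · obtain ⟨b, hb0, hb1⟩ := ih (2 * x - 1) (by linarith) (by linarith)
      refine ⟨Fin.cons true b, ?_, ?_⟩ <;> rw [key] <;> simp only [if_true]
      · linarith
      · rw [pow_succ]; linarith

/-- The complexity at a resolution `m ≥ 1` of a vector in `[0,1]^n` is finite. -/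
theorem resK_ne_top {U : List Bool → List Bool →. List Bool} (hU : IsOptimalPrefixMachine U)
    {m n : ℕ} (hm : 0 < m) {x : Fin n → ℝ} (hx : x ∈ Set.Icc (0 : Fin n → ℝ) 1) :
    resK U m x ≠ ⊤ := by
  choose b hb0 hb1 using fun i => exists_binary_approx m (x i) (hx.1 i) (hx.2 i)
  set u : Fin n → ℝ := fun i => ∑ j : Fin m, if b i j then (2 : ℝ)⁻¹ ^ ((j : ℕ) + 1) else 0
    with hu
  have hu01 : u ∈ Set.Icc (0 : Fin n → ℝ) 1 := by
    refine ⟨fun i => ?_, fun i => ?_⟩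
    · exact Finset.sum_nonneg fun j _ => by split_ifs <;> positivity
    · have h1 := hb0 i
      have h2 : x i ≤ 1 := hx.2 i
      change (∑ j : Fin m, if b i j then (2 : ℝ)⁻¹ ^ ((j : ℕ) + 1) else 0) ≤ 1
      linarith
  have hclose : ∀ i, |x i - u i| ≤ (2 : ℝ)⁻¹ ^ m := fun i =>
    abs_le.2 ⟨le_trans (neg_nonpos.2 (by positivity)) (hb0 i), hb1 i⟩
  have hw : IsBinaryExpansion u (List.ofFn fun i => List.ofFn (b i)).flatten :=
    ⟨m, hm, b, rfl, fun _ => rfl⟩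
  refine ne_top_of_le_ne_top (condK_ne_top hU _ (sideInfo n m)) (?_ :
    resK U m x ≤ condK U (List.ofFn fun i => List.ofFn (b i)).flatten (sideInfo n m))
  unfold resK vecK
  exact iInf_le_of_le u (iInf_le_of_le hu01 (iInf_le_of_le hclose
    (iInf_le_of_le _ (iInf_le_of_le hw le_rfl))))

/-!
Let `k` be the complexity of `xo` at resolution `m`. The solution `xhat` has complexity at most `k`, so
both vectors are within `2⁻ᵐ ≤ 1 / n`, in every coordinate, of vectors `u` and `s` printed by programs
of length at most `k`. Fix `u`; then `s` ranges over at most `2 ^ (k + 1)` vectors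
(`exists_finset_vectors`). The error `z = xo - xhat` lies in the kernel of `A` and
`‖z - (u - s)‖₂ ≤ 2 / √n`. It remains to bound, for a fixed `v = u - s`, the probability that the
kernel of `A` contains a vector `z` with `‖z‖₂ > 20 / √d` and `‖z - v‖₂ ≤ 2 / √n`
(`measure_kernel_near_le`).

Complete `v / ‖v‖` to an orthonormal basis `b`. The vectors `C k = A (b k)` are independent standard
Gaussian vectors of `ℝᵈ` (`hasLaw_columns_orthonormalBasis`). With `g = C 0`, the relation
`⟨g, A z⟩ = 0` and the Cauchy–Schwarz inequality
(`mul_sq_sum_sq_le_of_sum_mul_eq_zero`) give `|g|² ≤ d / (99 n) * ∑_{k ≥ 1} ⟨g / |g|, C k⟩²`. Here `|g|²` is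
a chi-squared variable with `d` degrees of freedom, and the sum is an independent one with `n - 1`, so
the event asks for a ratio about a hundred times smaller than the typical one; by Chernoff's method its
probability is at most `5 ^ (-d)` (`measure_pi_gaussianReal_sq_le`,
`inv_sqrt_pow_mul_inv_sqrt_pow_le`). No bound on the largest singular
value of `A` enters, and so nothing is lost when `d` is close to `n`.

Finally `m ≤ (3 / 2) log₂ n` gives `k ≤ 3 d / 2`, and `2 ^ (k + 1) 5 ^ (-d) < 2 exp (-d / 2)` because
`8 e < 25`.
-/

/-! ### Exponential moments of Gaussian quadratic forms -/

theorem lintegral_exp_mul_sq_gaussianReal {a : ℝ} (ha : a < 1 / 2) :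
    ∫⁻ x, ENNReal.ofReal (Real.exp (a * x ^ 2)) ∂gaussianReal 0 1
      = ENNReal.ofReal (√(1 - 2 * a))⁻¹ := by
  have hb : 0 < 1 / 2 - a := by linarith
  have hpdf : ∀ x : ℝ, gaussianPDFReal 0 1 x * Real.exp (a * x ^ 2)
      = (√(2 * Real.pi))⁻¹ * Real.exp (-(1 / 2 - a) * x ^ 2) := by
    intro x
    rw [gaussianPDFReal, mul_assoc, ← Real.exp_add]
    simp only [NNReal.coe_one, mul_one, sub_zero]
    congr 2
    ring
  rw [gaussianReal_of_var_ne_zero 0 one_ne_zero,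
    lintegral_withDensity_eq_lintegral_mul _ (measurable_gaussianPDF 0 1) (by fun_prop)]
  have : ∀ x : ℝ, (gaussianPDF 0 1 * fun x => ENNReal.ofReal (Real.exp (a * x ^ 2))) x
      = ENNReal.ofReal ((√(2 * Real.pi))⁻¹ * Real.exp (-(1 / 2 - a) * x ^ 2)) := by
    intro x
    rw [← hpdf, ENNReal.ofReal_mul (gaussianPDFReal_nonneg 0 1 x)]
    rfl
  simp_rw [this]
  rw [← ofReal_integral_eq_lintegral_ofReal ((integrable_exp_neg_mul_sq hb).const_mul _)
    (Filter.Eventually.of_forall fun x => by positivity), integral_const_mul, integral_gaussian]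
  congr 1
  rw [← Real.sqrt_inv, ← Real.sqrt_inv, ← Real.sqrt_mul (by positivity)]
  congr 1
  have h2 : (1 - 2 * a) ≠ 0 := by linarith
  have h3 := hb.ne'
  have := Real.pi_pos.ne'
  field_simp

theorem lintegral_pi_prod {ι : Type*} [Fintype ι] {X : ι → Type*} [∀ i, MeasurableSpace (X i)]
    (μ : ∀ i, Measure (X i)) [∀ i, IsProbabilityMeasure (μ i)]
    {f : ∀ i, X i → ENNReal} (hf : ∀ i, Measurable (f i)) :
    ∫⁻ x, ∏ i, f i (x i) ∂Measure.pi μ = ∏ i, ∫⁻ x, f i x ∂μ i := by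
  rw [lintegral_prod_eq_prod_lintegral_of_indepFun Finset.univ (fun i (x : ∀ i, X i) => f i (x i))
    (iIndepFun_pi fun i => (hf i).aemeasurable) fun i => (hf i).comp (measurable_pi_apply i)]
  refine Finset.prod_congr rfl fun i _ => ?_
  rw [← (measurePreserving_eval μ i).lintegral_comp (hf i)]

theorem lintegral_exp_mul_sum_sq_pi_gaussianReal {ι : Type*} [Fintype ι] {a : ℝ} (ha : a < 1 / 2) :
    ∫⁻ x : ι → ℝ, ENNReal.ofReal (Real.exp (a * ∑ i, x i ^ 2))
        ∂Measure.pi (fun _ => gaussianReal 0 1)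
      = ENNReal.ofReal (√(1 - 2 * a))⁻¹ ^ Fintype.card ι := by
  have : ∀ x : ι → ℝ, ENNReal.ofReal (Real.exp (a * ∑ i, x i ^ 2))
      = ∏ i, ENNReal.ofReal (Real.exp (a * x i ^ 2)) := by
    intro x
    rw [Finset.mul_sum, Real.exp_sum, ENNReal.ofReal_prod_of_nonneg fun i _ => (Real.exp_pos _).le]
  simp_rw [this]
  rw [lintegral_pi_prod (f := fun _ y => ENNReal.ofReal (Real.exp (a * y ^ 2))) _
    fun _ => by fun_prop]
  simp [lintegral_exp_mul_sq_gaussianReal ha]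

theorem map_sum_mul_pi_gaussianReal {ι : Type*} [Fintype ι] {u : ι → ℝ} (hu : ∑ i, u i ^ 2 = 1) :
    (Measure.pi fun _ : ι => gaussianReal 0 1).map (fun x => ∑ i, u i * x i)
      = gaussianReal 0 1 := by
  have hL : (fun x : ι → ℝ => ∑ i, u i * x i)
      = (innerSL ℝ (WithLp.toLp 2 u : EuclideanSpace ℝ ι)) ∘ WithLp.toLp 2 := by
    ext x
    simp [PiLp.inner_apply, mul_comm]
  rw [hL, ← Measure.map_map (by fun_prop) (by fun_prop), map_pi_eq_stdGaussian,
    IsGaussian.map_eq_gaussianReal, variance_dual_stdGaussian, integral_strongDual_stdGaussian]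
  rw [innerSL_apply_norm, EuclideanSpace.real_norm_sq_eq]
  simp [hu]

/-- Exponential moment of the square of a Gaussian linear form. The degenerate form `u = 0` is
allowed, so that the bound also applies to the normalization of a zero vector. -/
theorem lintegral_exp_mul_sq_sum_mul_le {ι : Type*} [Fintype ι] {a : ℝ} (ha0 : 0 ≤ a)
    (ha : a < 1 / 2) {u : ι → ℝ} (hu : u = 0 ∨ ∑ i, u i ^ 2 = 1) :
    ∫⁻ x : ι → ℝ, ENNReal.ofReal (Real.exp (a * (∑ i, u i * x i) ^ 2))
        ∂Measure.pi (fun _ => gaussianReal 0 1)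
      ≤ ENNReal.ofReal (√(1 - 2 * a))⁻¹ := by
  rcases hu with rfl | hu
  · simp only [Pi.zero_apply, zero_mul, Finset.sum_const_zero, ne_eq, OfNat.ofNat_ne_zero,
      not_false_eq_true, zero_pow, mul_zero, Real.exp_zero, ENNReal.ofReal_one, lintegral_const,
      measure_univ, mul_one]
    rw [ENNReal.one_le_ofReal]
    refine (one_le_inv₀ (Real.sqrt_pos.2 (by linarith))).2 ?_
    exact Real.sqrt_le_one.2 (by linarith)
  · have h := lintegral_exp_mul_sq_gaussianReal ha
    rw [← map_sum_mul_pi_gaussianReal hu, lintegral_map (by fun_prop) (by fun_prop)] at h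
    exact h.le

/-! ### Images of an orthonormal basis under a Gaussian matrix -/

/-- Currying is measure preserving. The reindexing `e` covers both the row-by-row and the
column-by-column arrangement of a matrix of independent entries. -/
theorem measurePreserving_pi_curry {J κ ι : Type*} [Fintype J] [Fintype κ] [Fintype ι]
    {X : Type*} [MeasurableSpace X] (μ : Measure X) [IsProbabilityMeasure μ] (e : κ × ι ≃ J) :
    MeasurePreserving (fun (x : J → X) (k : κ) (i : ι) => x (e (k, i)))
      (Measure.pi fun _ => μ) (Measure.pi fun _ => Measure.pi fun _ => μ) := by
  let E : (J → X) ≃ᵐ (κ → ι → X) :=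
    { toFun := fun x k i => x (e (k, i))
      invFun := fun y j => y (e.symm j).1 (e.symm j).2
      left_inv := fun x => by simp
      right_inv := fun y => by simp
      measurable_toFun := by
        change Measurable (fun (x : J → X) (k : κ) (i : ι) => x (e (k, i)))
        fun_prop
      measurable_invFun := by
        change Measurable (fun (y : κ → ι → X) j => y (e.symm j).1 (e.symm j).2)
        fun_prop }
  have h : MeasurePreserving E.symm (Measure.pi fun _ => Measure.pi fun _ => μ)
      (Measure.pi fun _ : J => μ) := by
    refine ⟨E.symm.measurable, (Measure.pi_eq fun s hs => ?_).symm⟩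
    rw [Measure.map_apply E.symm.measurable (MeasurableSet.univ_pi hs)]
    have : E.symm ⁻¹' Set.univ.pi s
        = Set.univ.pi fun k => Set.univ.pi fun i => s (e (k, i)) := by
      ext y
      simp only [Set.mem_preimage, Set.mem_univ_pi]
      refine ⟨fun h k i => ?_, fun h j => ?_⟩
      · simpa [E] using h (e (k, i))
      · have := h (e.symm j).1 (e.symm j).2
        simpa [E] using this
    rw [this, Measure.pi_pi]
    simp_rw [Measure.pi_pi]
    rw [← Fintype.prod_prod_type' fun k i => μ (s (e (k, i)))]
    exact e.prod_comp fun j => μ (s j)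
  exact h.symm

/-- Rotation invariance of the standard Gaussian measure, in coordinates. -/
theorem measurePreserving_repr_pi_gaussianReal {ι : Type*} [Fintype ι]
    (b : OrthonormalBasis ι ℝ (EuclideanSpace ℝ ι)) :
    MeasurePreserving (fun (x : ι → ℝ) k => ∑ j, b k j * x j)
      (Measure.pi fun _ => gaussianReal 0 1) (Measure.pi fun _ => gaussianReal 0 1) := by
  have hL : (fun (x : ι → ℝ) k => ∑ j, b k j * x j)
      = WithLp.ofLp ∘ b.repr ∘ WithLp.toLp 2 := by
    ext x k
    simp [b.repr_apply_apply, PiLp.inner_apply, mul_comm]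
  refine ⟨by fun_prop, ?_⟩
  rw [hL, ← Measure.map_map (by fun_prop) (by fun_prop),
    ← Measure.map_map (by fun_prop) (by fun_prop), map_pi_eq_stdGaussian, stdGaussian_map,
    ← map_pi_eq_stdGaussian, Measure.map_map (by fun_prop) (by fun_prop)]
  exact Measure.map_id

/-- The images `A (b k)` of an orthonormal basis under a Gaussian matrix are independent standard
Gaussian vectors: each row is rotated by `b`, and the result is read column by column. -/
theorem hasLaw_columns_orthonormalBasis {Ω : Type*} [MeasurableSpace Ω] {P : Measure Ω}
    [IsProbabilityMeasure P] {d n : ℕ} {A : Ω → Matrix (Fin d) (Fin n) ℝ}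
    (hA_law : ∀ i j, HasLaw (fun ω => A ω i j) (gaussianReal 0 1) P)
    (hA_indep : iIndepFun (fun (ij : Fin d × Fin n) ω => A ω ij.1 ij.2) P)
    (b : OrthonormalBasis (Fin n) ℝ (EuclideanSpace ℝ (Fin n))) :
    HasLaw (fun ω (k : Fin n) (i : Fin d) => ∑ j, b k j * A ω i j)
      (Measure.pi fun _ => Measure.pi fun _ => gaussianReal 0 1) P := by
  have hmeas : ∀ ij : Fin d × Fin n, AEMeasurable (fun ω => A ω ij.1 ij.2) P :=
    fun ij => (hA_law ij.1 ij.2).aemeasurable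
  have h0 : HasLaw (fun ω (ij : Fin d × Fin n) => A ω ij.1 ij.2)
      (Measure.pi fun _ => gaussianReal 0 1) P := by
    refine ⟨aemeasurable_pi_lambda _ hmeas, ?_⟩
    rw [hA_indep.map_fun_eq_pi_map hmeas]
    congr 1
    ext1 ij
    exact (hA_law ij.1 ij.2).map_eq
  have h1 := measurePreserving_pi_curry (gaussianReal 0 1) (Equiv.refl (Fin d × Fin n))
  have h2 := measurePreserving_pi (fun _ : Fin d => Measure.pi fun _ => gaussianReal 0 1)
    (fun _ : Fin d => Measure.pi fun _ => gaussianReal 0 1)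
    fun _ => measurePreserving_repr_pi_gaussianReal b
  -- Transposition, factored through the product over pairs of indices.
  have h3 : MeasurePreserving (fun (x : Fin d → Fin n → ℝ) k i => x i k)
      (Measure.pi fun _ => Measure.pi fun _ => gaussianReal 0 1)
      (Measure.pi fun _ => Measure.pi fun _ => gaussianReal 0 1) := by
    have := (measurePreserving_pi_curry (gaussianReal 0 1) (Equiv.prodComm (Fin n) (Fin d))).comp
      (h1.symm (MeasurableEquiv.curry (Fin d) (Fin n) ℝ))
    exact this
  exact (h3.comp (h2.comp h1)).hasLaw.comp h0

/-! ### Vectors of the kernel close to a fixed vector -/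

/-- Chernoff bound with parameter `l` for the event `|g|² ≤ τ ∑ₖ ⟨g / |g|, Cₖ⟩²`, where `g = C 0` and
the `Cₖ` are independent standard Gaussian vectors. Conditionally on `g` the numbers
`⟨g / |g|, Cₖ⟩` are independent standard Gaussian variables, so the right-hand sum is a chi-squared
variable with `n` degrees of freedom independent of `|g|²`. The event is written without
division. -/
theorem measure_pi_gaussianReal_sq_le (d n : ℕ) {τ l : ℝ} (hτ : 0 ≤ τ) (hl : 0 ≤ l)
    (hlτ : l * τ < 1 / 2) :
    (Measure.pi fun _ : Fin (n + 1) => Measure.pi fun _ : Fin d => gaussianReal 0 1)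
        {C | (∑ i, C 0 i ^ 2) ^ 2 ≤ τ * ∑ k : Fin n, (∑ i, C 0 i * C k.succ i) ^ 2}
      ≤ ENNReal.ofReal (√(1 + 2 * l))⁻¹ ^ d * ENNReal.ofReal (√(1 - 2 * (l * τ)))⁻¹ ^ n := by
  let γ : Measure (Fin d → ℝ) := Measure.pi fun _ => gaussianReal 0 1
  -- The normalization `g / |g|`, equal to `0` at `g = 0`.
  let u : (Fin d → ℝ) → Fin d → ℝ := fun g i => (√(∑ i, g i ^ 2))⁻¹ * g i
  have hu : ∀ g, u g = 0 ∨ ∑ i, u g i ^ 2 = 1 := by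
    intro g
    have h0 : 0 ≤ ∑ i, g i ^ 2 := Finset.sum_nonneg fun i _ => sq_nonneg _
    rcases h0.eq_or_lt with h | h
    · left
      ext i
      simp [u, ← h]
    · right
      simp only [u, mul_pow, ← Finset.mul_sum, inv_pow, Real.sq_sqrt h0]
      exact inv_mul_cancel₀ h.ne'
  let F : (Fin d → ℝ) × (Fin n → Fin d → ℝ) → ENNReal := fun p =>
    ENNReal.ofReal (Real.exp (-l * ∑ i, p.1 i ^ 2)) *
      ∏ k, ENNReal.ofReal (Real.exp (l * τ * (∑ i, u p.1 i * p.2 k i) ^ 2))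
  have hF : Measurable F := by fun_prop
  have hmp := measurePreserving_piFinSuccAbove (fun _ : Fin (n + 1) => γ) 0
  have hsub : {C : Fin (n + 1) → Fin d → ℝ |
        (∑ i, C 0 i ^ 2) ^ 2 ≤ τ * ∑ k : Fin n, (∑ i, C 0 i * C k.succ i) ^ 2}
      ⊆ {C | 1 ≤ F (MeasurableEquiv.piFinSuccAbove (fun _ => Fin d → ℝ) 0 C)} := by
    intro C hC
    have hFC : F (MeasurableEquiv.piFinSuccAbove (fun _ => Fin d → ℝ) 0 C)
        = ENNReal.ofReal (Real.exp (-l * ∑ i, C 0 i ^ 2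
          + ∑ k : Fin n, l * τ * (∑ i, u (C 0) i * C k.succ i) ^ 2)) := by
      rw [Real.exp_add, ENNReal.ofReal_mul (Real.exp_pos _).le, Real.exp_sum,
        ENNReal.ofReal_prod_of_nonneg fun i _ => (Real.exp_pos _).le]
      rfl
    simp only [Set.mem_ofPred_eq] at hC ⊢
    rw [hFC, ENNReal.one_le_ofReal, Real.one_le_exp_iff, ← Finset.mul_sum]
    have hT : 0 ≤ ∑ k : Fin n, (∑ i, u (C 0) i * C k.succ i) ^ 2 :=
      Finset.sum_nonneg fun i _ => sq_nonneg _
    have hscale : ∑ k : Fin n, (∑ i, u (C 0) i * C k.succ i) ^ 2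
        = (∑ i, C 0 i ^ 2)⁻¹ * ∑ k : Fin n, (∑ i, C 0 i * C k.succ i) ^ 2 := by
      rw [Finset.mul_sum]
      refine Finset.sum_congr rfl fun k _ => ?_
      simp only [u, mul_assoc, ← Finset.mul_sum]
      rw [mul_pow, inv_pow, Real.sq_sqrt (Finset.sum_nonneg fun i _ => sq_nonneg _)]
    have h0 : 0 ≤ ∑ i, C 0 i ^ 2 := Finset.sum_nonneg fun i _ => sq_nonneg _
    have key : ∑ i, C 0 i ^ 2 ≤ τ * ∑ k : Fin n, (∑ i, u (C 0) i * C k.succ i) ^ 2 := by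
      rcases h0.eq_or_lt with h | h
      · rw [← h]; positivity
      · rw [hscale, mul_left_comm, inv_mul_eq_div, le_div_iff₀ h, ← sq]
        exact hC
    have := mul_le_mul_of_nonneg_left key hl
    linarith
  calc _ ≤ _ := measure_mono hsub
    _ ≤ ∫⁻ C, F (MeasurableEquiv.piFinSuccAbove (fun _ => Fin d → ℝ) 0 C)
          ∂(Measure.pi fun _ => γ) := by
        simpa using mul_meas_ge_le_lintegral (μ := Measure.pi fun _ => γ)
          (hF.comp (MeasurableEquiv.piFinSuccAbove (fun _ => Fin d → ℝ) 0).measurable) 1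
    _ = ∫⁻ p, F p ∂(γ.prod (Measure.pi fun _ => γ)) := hmp.lintegral_comp hF
    _ = ∫⁻ g, ∫⁻ B, F (g, B) ∂(Measure.pi fun _ => γ) ∂γ := lintegral_prod _ hF.aemeasurable
    _ ≤ ∫⁻ g, ENNReal.ofReal (Real.exp (-l * ∑ i, g i ^ 2)) *
          ENNReal.ofReal (√(1 - 2 * (l * τ)))⁻¹ ^ n ∂γ := by
        refine lintegral_mono fun g => ?_
        simp only [F]
        rw [lintegral_const_mul _ (by fun_prop)]
        gcongr
        rw [lintegral_pi_prod (X := fun _ => Fin d → ℝ) (f := fun _ x =>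
          ENNReal.ofReal (Real.exp (l * τ * (∑ i, u g i * x i) ^ 2))) _ fun _ => by fun_prop]
        calc _ ≤ ∏ _k : Fin n, ENNReal.ofReal (√(1 - 2 * (l * τ)))⁻¹ := by
              refine Finset.prod_le_prod' fun k _ => ?_
              exact lintegral_exp_mul_sq_sum_mul_le (by positivity) hlτ (hu g)
          _ = _ := by simp
    _ = _ := by
        rw [lintegral_mul_const _ (by fun_prop),
          lintegral_exp_mul_sum_sq_pi_gaussianReal (by linarith)]
        simp

/-- If `z` is in the kernel of the matrix with columns `C k`, then pairing `∑ zₖ Cₖ = 0` with `C 0`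
gives `z₀ |C 0|² = -∑_{k ≥ 1} zₖ ⟨C 0, Cₖ⟩`, and Cauchy–Schwarz bounds `|C 0|` as soon as `z` is close
to the line of the coordinate `0`. -/
theorem mul_sq_sum_sq_le_of_sum_mul_eq_zero {d n : ℕ} {z : Fin (n + 1) → ℝ}
    {C : Fin (n + 1) → Fin d → ℝ} {r R : ℝ}
    (hker : ∀ i, ∑ k, z k * C k i = 0)
    (hr : ∑ k : Fin n, z k.succ ^ 2 ≤ r) (hR : R ≤ ∑ k, z k ^ 2) :
    (R - r) * (∑ i, C 0 i ^ 2) ^ 2 ≤ r * ∑ k : Fin n, (∑ i, C 0 i * C k.succ i) ^ 2 := by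
  have h0 : z 0 * ∑ i, C 0 i ^ 2 + ∑ k : Fin n, z k.succ * ∑ i, C 0 i * C k.succ i = 0 := by
    have : ∑ i, C 0 i * ∑ k, z k * C k i = 0 := by simp [hker]
    rw [← this]
    simp_rw [Finset.mul_sum]
    rw [Finset.sum_comm (s := (Finset.univ : Finset (Fin d))), Fin.sum_univ_succ]
    congr 1
    · exact Finset.sum_congr rfl fun i _ => by ring
    · exact Finset.sum_congr rfl fun k _ => Finset.sum_congr rfl fun i _ => by ring
  have hcs := Finset.sum_mul_sq_le_sq_mul_sq Finset.univ (fun k : Fin n => z k.succ)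
    (fun k : Fin n => ∑ i, C 0 i * C k.succ i)
  rw [show ∑ k : Fin n, z k.succ * ∑ i, C 0 i * C k.succ i = -(z 0 * ∑ i, C 0 i ^ 2) by
    linarith, neg_sq, mul_pow] at hcs
  rw [Fin.sum_univ_succ] at hR
  have hS : 0 ≤ ∑ k : Fin n, (∑ i, C 0 i * C k.succ i) ^ 2 :=
    Finset.sum_nonneg fun i _ => sq_nonneg _
  calc _ ≤ z 0 ^ 2 * (∑ i, C 0 i ^ 2) ^ 2 := by gcongr; linarith
    _ ≤ _ := hcs
    _ ≤ _ := by gcongr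

theorem sqrt_pow_nat {x : ℝ} (hx : 0 ≤ x) (n : ℕ) : √(x ^ n) = √x ^ n := by
  rw [Real.sqrt_eq_iff_mul_self_eq (by positivity) (by positivity), ← mul_pow,
    Real.mul_self_sqrt hx]

/-- The Chernoff bound evaluated at `τ = d / (99 (n + 1))` and parameter `25`. As
`δ = d / (n + 1) ≤ 1`, Bernoulli's inequality gives `1 - 50 δ / 99 ≥ (49 / 99) ^ δ`, and
`51 * 49 / 99 ≥ 5 ^ 2`. -/
theorem inv_sqrt_pow_mul_inv_sqrt_pow_le {d n : ℕ} (hd : 0 < d) (hdn : d ≤ n + 1) :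
    (√(1 + 2 * 25))⁻¹ ^ d * (√(1 - 2 * (25 * (d / (99 * (n + 1 : ℝ))))))⁻¹ ^ n
      ≤ (5 : ℝ)⁻¹ ^ d := by
  set δ : ℝ := d / (n + 1 : ℝ) with hδ
  have hn : (0 : ℝ) < n + 1 := by positivity
  have hδ0 : 0 ≤ δ := by positivity
  have hδ1 : δ ≤ 1 := (div_le_one hn).2 (by exact_mod_cast hdn)
  have hB : (49 / 99 : ℝ) ^ δ ≤ 1 - 2 * (25 * (d / (99 * (n + 1 : ℝ)))) := by
    have := rpow_one_add_le_one_add_mul_self (s := -(50 / 99)) (by norm_num) hδ0 hδ1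
    convert this using 1
    · norm_num
    · rw [hδ]; field_simp; ring
  have hpos : (0 : ℝ) < (49 / 99 : ℝ) ^ δ := by positivity
  have hpow : (49 / 99 : ℝ) ^ d ≤ ((49 / 99 : ℝ) ^ δ) ^ n := by
    rw [← Real.rpow_natCast, ← Real.rpow_natCast, ← Real.rpow_mul (by norm_num)]
    refine Real.rpow_le_rpow_of_exponent_ge (by norm_num) (by norm_num) ?_
    rw [hδ, div_mul_eq_mul_div, div_le_iff₀ hn]
    gcongr
    linarith
  rw [inv_pow, inv_pow, inv_pow, ← mul_inv]
  gcongr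
  calc (5 : ℝ) ^ d ≤ √((1 + 2 * 25) * (49 / 99)) ^ d := by
        gcongr
        exact Real.le_sqrt_of_sq_le (by norm_num)
    _ = √(1 + 2 * 25) ^ d * √((49 / 99) ^ d) := by
        rw [Real.sqrt_mul (by norm_num), mul_pow, sqrt_pow_nat (by norm_num)]
    _ ≤ √(1 + 2 * 25) ^ d * √((1 - 2 * (25 * (d / (99 * (n + 1 : ℝ))))) ^ n) := by
        gcongr
        exact hpow.trans (by gcongr)
    _ = _ := by rw [sqrt_pow_nat (hpos.le.trans hB)]

theorem exists_orthonormalBasis_zero_eq {n : ℕ} {v : EuclideanSpace ℝ (Fin (n + 1))}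
    (hv : v ≠ 0) : ∃ b : OrthonormalBasis (Fin (n + 1)) ℝ (EuclideanSpace ℝ (Fin (n + 1))),
      v = ‖v‖ • b 0 := by
  obtain ⟨b, hb⟩ := Orthonormal.exists_orthonormalBasis_extension_of_card_eq (𝕜 := ℝ)
    (E := EuclideanSpace ℝ (Fin (n + 1))) (ι := Fin (n + 1)) (by simp)
    (v := fun _ => ‖v‖⁻¹ • v) (s := {0}) (by
      rw [orthonormal_iff_ite]
      rintro ⟨i, rfl⟩ ⟨j, rfl⟩
      simp only [Set.domRestrict_apply, if_true, real_inner_self_eq_norm_sq, norm_smul, norm_inv,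
        norm_norm]
      rw [inv_mul_cancel₀ (norm_ne_zero_iff.2 hv), one_pow])
  refine ⟨b, ?_⟩
  rw [hb 0 rfl, smul_inv_smul₀ (norm_ne_zero_iff.2 hv)]

/-- The kernel of a Gaussian `d × n` matrix is unlikely to contain a vector of norm more than
`20 / √d` within `2 / √n` of a fixed vector `v`. In an orthonormal basis starting with `v / ‖v‖`, such
a vector `z` has all but its first coordinate of total square at most `4 / n`, against
`400 / d ≥ 400 / n` for the whole. -/
theorem measure_kernel_near_le {Ω : Type*} [MeasurableSpace Ω] {P : Measure Ω}
    [IsProbabilityMeasure P] {d n : ℕ} (hd : 0 < d) (hdn : d ≤ n)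
    {A : Ω → Matrix (Fin d) (Fin n) ℝ}
    (hA_law : ∀ i j, HasLaw (fun ω => A ω i j) (gaussianReal 0 1) P)
    (hA_indep : iIndepFun (fun (ij : Fin d × Fin n) ω => A ω ij.1 ij.2) P)
    (v : Fin n → ℝ) :
    P {ω | ∃ z : Fin n → ℝ, (A ω).mulVec z = 0 ∧ 20 / √(d : ℝ) < ‖WithLp.toLp 2 z‖ ∧
        ‖WithLp.toLp 2 (z - v)‖ ≤ 2 / √(n : ℝ)}
      ≤ ENNReal.ofReal (5⁻¹ ^ d) := by
  obtain ⟨n, rfl⟩ : ∃ k, n = k + 1 := ⟨n - 1, by omega⟩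
  have hd' : (0 : ℝ) < d := by exact_mod_cast hd
  have hn' : (0 : ℝ) < (n + 1 : ℕ) := by positivity
  have hdn' : (d : ℝ) ≤ (n + 1 : ℕ) := by exact_mod_cast hdn
  -- There is no direction `v / ‖v‖` for `v = 0`, but then the event is empty as `2 / √n ≤ 20 / √d`.
  by_cases hv : WithLp.toLp 2 v = 0
  · have hempty : {ω | ∃ z : Fin (n + 1) → ℝ, (A ω).mulVec z = 0 ∧
        20 / √(d : ℝ) < ‖WithLp.toLp 2 z‖ ∧
        ‖WithLp.toLp 2 (z - v)‖ ≤ 2 / √((n + 1 : ℕ) : ℝ)} = ∅ := by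
      ext ω
      simp only [Set.mem_ofPred_eq, Set.mem_empty_iff_false, iff_false]
      rintro ⟨z, -, h1, h2⟩
      rw [WithLp.toLp_sub, hv, sub_zero] at h2
      have : 2 / √((n + 1 : ℕ) : ℝ) ≤ 20 / √(d : ℝ) := by
        gcongr
        norm_num
      linarith
    rw [hempty]
    simp
  obtain ⟨b, hb⟩ := exists_orthonormalBasis_zero_eq hv
  have hlaw := hasLaw_columns_orthonormalBasis hA_law hA_indep b
  set τ : ℝ := d / (99 * (n + 1 : ℝ)) with hτ
  have hτ0 : 0 ≤ τ := by positivity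
  have hτ1 : τ ≤ 1 / 99 := by
    rw [hτ, div_le_div_iff₀ (by positivity) (by norm_num)]
    push_cast at hdn'
    linarith
  have hmeas : MeasurableSet {C : Fin (n + 1) → Fin d → ℝ |
      (∑ i, C 0 i ^ 2) ^ 2 ≤ τ * ∑ k : Fin n, (∑ i, C 0 i * C k.succ i) ^ 2} :=
    measurableSet_le (by fun_prop) (by fun_prop)
  calc _ ≤ P ((fun ω (k : Fin (n + 1)) (i : Fin d) => ∑ j, b k j * A ω i j) ⁻¹' {C |
        (∑ i, C 0 i ^ 2) ^ 2 ≤ τ * ∑ k : Fin n, (∑ i, C 0 i * C k.succ i) ^ 2}) := by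
        refine measure_mono ?_
        rintro ω ⟨z, hz, hz1, hz2⟩
        set ζ : Fin (n + 1) → ℝ := fun k => b.repr (WithLp.toLp 2 z) k with hζ
        have hrepr : ∀ j, z j = ∑ k, ζ k * b k j := by
          intro j
          have := congrArg (fun x : EuclideanSpace ℝ (Fin (n + 1)) => x j)
            (b.sum_repr (WithLp.toLp 2 z))
          simpa [hζ] using this.symm
        have hker : ∀ i, ∑ k, ζ k * ∑ j, b k j * A ω i j = 0 := by
          intro i
          have h := congrFun hz i
          simp only [Matrix.mulVec, dotProduct, Pi.zero_apply] at h
          rw [← h]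
          simp_rw [hrepr, Finset.mul_sum]
          rw [Finset.sum_comm]
          exact Finset.sum_congr rfl fun j _ => Finset.sum_congr rfl fun k _ => by ring
        have hnorm : ∑ k, ζ k ^ 2 = ‖WithLp.toLp 2 z‖ ^ 2 := by
          rw [← b.repr.norm_map, EuclideanSpace.real_norm_sq_eq]
        have hR : 400 / (d : ℝ) ≤ ∑ k, ζ k ^ 2 := by
          rw [hnorm]
          calc 400 / (d : ℝ) = (20 / √(d : ℝ)) ^ 2 := by
                rw [div_pow, Real.sq_sqrt hd'.le]; norm_num
            _ ≤ _ := by gcongr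
        have hr : ∑ k : Fin n, ζ k.succ ^ 2 ≤ 4 / (n + 1 : ℝ) := by
          have hperp : ∀ k : Fin n, ζ k.succ = b.repr (WithLp.toLp 2 (z - v)) k.succ := by
            intro k
            have hvk : b.repr (WithLp.toLp 2 v) k.succ = 0 := by
              rw [hb, map_smul, b.repr_self]
              simp [Fin.succ_ne_zero]
            rw [WithLp.toLp_sub, map_sub, PiLp.sub_apply, hvk, sub_zero]
          calc ∑ k : Fin n, ζ k.succ ^ 2
              ≤ ∑ k, (b.repr (WithLp.toLp 2 (z - v)) k) ^ 2 := by
                rw [Fin.sum_univ_succ]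
                simp_rw [hperp]
                linarith [sq_nonneg (b.repr (WithLp.toLp 2 (z - v)) 0)]
            _ = ‖WithLp.toLp 2 (z - v)‖ ^ 2 := by
                rw [← b.repr.norm_map, EuclideanSpace.real_norm_sq_eq]
            _ ≤ (2 / √((n + 1 : ℕ) : ℝ)) ^ 2 := by gcongr
            _ = _ := by
                rw [div_pow, Real.sq_sqrt hn'.le]; push_cast; norm_num
        have key := mul_sq_sum_sq_le_of_sum_mul_eq_zero
          (C := fun k i => ∑ j, b k j * A ω i j) hker hr hR
        simp only [Set.mem_preimage, Set.mem_ofPred_eq]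
        set N := (∑ i, (∑ j, b 0 j * A ω i j) ^ 2) ^ 2
        set S := ∑ k : Fin n, (∑ i, (∑ j, b 0 j * A ω i j) * ∑ j, b k.succ j * A ω i j) ^ 2
        have hN : 0 ≤ N := by positivity
        -- `4 / n ≤ 4 / d`, so the constant is `(4 / n) / (396 / d) = d / (99 n) = τ`.
        have hcoef : 396 / (d : ℝ) ≤ 400 / d - 4 / (n + 1 : ℝ) := by
          have : 4 / (n + 1 : ℝ) ≤ 4 / d := by
            gcongr
            push_cast at hdn'
            exact hdn'
          have h' : 400 / (d : ℝ) = 396 / d + 4 / d := by ring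
          linarith
        have h1 := (mul_le_mul_of_nonneg_right hcoef hN).trans key
        rw [hτ]
        field_simp at h1 ⊢
        linarith
    _ = (Measure.pi fun _ => Measure.pi fun _ => gaussianReal 0 1) {C |
        (∑ i, C 0 i ^ 2) ^ 2 ≤ τ * ∑ k : Fin n, (∑ i, C 0 i * C k.succ i) ^ 2} := by
        rw [← hlaw.map_eq, Measure.map_apply_of_aemeasurable hlaw.aemeasurable hmeas]
    _ ≤ _ := measure_pi_gaussianReal_sq_le d n (l := 25) hτ0 (by norm_num) (by linarith)
    _ = ENNReal.ofReal ((√(1 + 2 * 25))⁻¹ ^ d * (√(1 - 2 * (25 * τ)))⁻¹ ^ n) := by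
        rw [ENNReal.ofReal_mul (by positivity), ENNReal.ofReal_pow (by positivity),
          ENNReal.ofReal_pow (by positivity)]
    _ ≤ _ := ENNReal.ofReal_le_ofReal (inv_sqrt_pow_mul_inv_sqrt_pow_le hd hdn)

/-! ### Counting vectors of low complexity -/

/-- A string determines the vector it expands: its length fixes the common number of bits. -/
theorem IsBinaryExpansion.unique {n : ℕ} (hn : 0 < n) {u u' : Fin n → ℝ} {w : List Bool}
    (h : IsBinaryExpansion u w) (h' : IsBinaryExpansion u' w) : u = u' := by
  obtain ⟨L, -, b, hw, hu⟩ := h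
  obtain ⟨L', -, b', hw', hu'⟩ := h'
  have hlen : L = L' := by
    have h1 : w.length = n * L := by rw [hw]; simp [List.sum_ofFn]
    have h2 : w.length = n * L' := by rw [hw']; simp [List.sum_ofFn]
    exact Nat.eq_of_mul_eq_mul_left hn (h1.symm.trans h2)
  subst hlen
  have hb : b = b' := by
    have := List.eq_iff_flatten_eq.2 ⟨hw.symm.trans hw', by simp [List.map_ofFn, Function.comp_def]⟩
    ext1 i
    exact List.ofFn_injective (congrFun (List.ofFn_injective this) i)
  ext i
  rw [hu, hu', hb]

theorem exists_program_of_resK_le {U : List Bool → List Bool →. List Bool} {m n k : ℕ}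
    {x : Fin n → ℝ} (h : resK U m x ≤ k) :
    ∃ u : Fin n → ℝ, (∀ i, |x i - u i| ≤ (2 : ℝ)⁻¹ ^ m) ∧
      ∃ p : List Bool, p.length ≤ k ∧ ∃ w ∈ U p (sideInfo n m), IsBinaryExpansion u w := by
  have h' : resK U m x < (k + 1 : ℕ) := h.trans_lt (by exact_mod_cast Nat.lt_succ_self k)
  simp only [resK, vecK, condK, iInf_lt_iff] at h'
  obtain ⟨u, -, hxu, w, hw, p, hp, hlt⟩ := h'
  exact ⟨u, hxu, p, Nat.lt_succ_iff.1 (by exact_mod_cast hlt), w, hp, hw⟩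

theorem exists_finset_lists_length_le (k : ℕ) :
    ∃ S : Finset (List Bool), S.card ≤ 2 ^ (k + 1) ∧ ∀ p : List Bool, p.length ≤ k → p ∈ S := by
  classical
  refine ⟨(Finset.range (k + 1)).biUnion fun l =>
    (Finset.univ : Finset (Fin l → Bool)).image List.ofFn, ?_, fun p hp => ?_⟩
  · refine Finset.card_biUnion_le.trans ?_
    calc _ ≤ ∑ l ∈ Finset.range (k + 1), 2 ^ l :=
          Finset.sum_le_sum fun l _ => Finset.card_image_le.trans (by simp)
      _ ≤ _ := (Nat.geomSum_lt le_rfl fun l hl => Finset.mem_range.1 hl).le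
  · simp only [Finset.mem_biUnion, Finset.mem_range, Finset.mem_image, Finset.mem_univ, true_and]
    exact ⟨p.length, Nat.lt_succ_iff.2 hp, p.get, List.ofFn_get p⟩

/-- There are at most `2 ^ (k + 1)` vectors of complexity at most `k`. Counting all strings of length
at most `k`, halting or not, is enough here. -/
theorem exists_finset_vectors (U : List Bool → List Bool →. List Bool) (y : List Bool) {n : ℕ}
    (hn : 0 < n) (k : ℕ) :
    ∃ S : Finset (Fin n → ℝ), S.card ≤ 2 ^ (k + 1) ∧ ∀ (u : Fin n → ℝ) (p w : List Bool),
      p.length ≤ k → w ∈ U p y → IsBinaryExpansion u w → u ∈ S := by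
  classical
  obtain ⟨T, hT, hTmem⟩ := exists_finset_lists_length_le k
  have hex : ∀ p, ∃ v : Fin n → ℝ, ∀ u, ∀ w ∈ U p y, IsBinaryExpansion u w → u = v := by
    intro p
    by_cases h : ∃ v : Fin n → ℝ, ∃ w ∈ U p y, IsBinaryExpansion v w
    · obtain ⟨v, w, hw, hv⟩ := h
      exact ⟨v, fun u w' hw' hu => hu.unique hn (Part.mem_unique hw hw' ▸ hv)⟩
    · exact ⟨0, fun u w hw hu => absurd ⟨u, w, hw, hu⟩ h⟩
  choose f hf using hex
  refine ⟨T.image f, Finset.card_image_le.trans hT, fun u p w hp hw hu => ?_⟩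
  exact Finset.mem_image.2 ⟨p, hTmem p hp, (hf p u w hw hu).symm⟩

/-! ### Numerical bounds -/

/-- The extreme cases are `n = 3`, where `3 ^ 3 ≥ 2 ^ 4` gives `logb 2 3 ≥ 4 / 3`, and `n ≥ 4`, where
`⌈logb 2 n⌉₊ ≤ logb 2 n + 1` and `logb 2 n ≥ 2`. -/
theorem natCeil_logb_two_le {n : ℕ} (hn : 2 ≤ n) :
    (⌈Real.logb 2 n⌉₊ : ℝ) ≤ 3 / 2 * Real.logb 2 n := by
  have hn0 : (0 : ℝ) < n := by positivity
  rcases lt_or_ge n 4 with h4 | h4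
  · interval_cases n
    · norm_num
    · have h1 : (4 / 3 : ℝ) ≤ Real.logb 2 3 := by
        rw [Real.le_logb_iff_rpow_le (by norm_num) (by norm_num)]
        refine le_of_pow_le_pow_left₀ (n := 3) (by norm_num) (by norm_num) ?_
        rw [← Real.rpow_natCast, ← Real.rpow_mul (by norm_num)]
        norm_num
      have h2 : ⌈Real.logb 2 3⌉₊ ≤ 2 := by
        rw [Nat.ceil_le, Real.logb_le_iff_le_rpow (by norm_num) (by norm_num)]
        norm_num
      have h3 : (⌈Real.logb 2 3⌉₊ : ℝ) ≤ 2 := by exact_mod_cast h2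
      push_cast
      linarith
  · have h1 : (2 : ℝ) ≤ Real.logb 2 n := by
      rw [Real.le_logb_iff_rpow_le (by norm_num) hn0]
      norm_num
      exact h4
    have := (Nat.ceil_lt_add_one (by linarith : 0 ≤ Real.logb 2 n)).le
    linarith

theorem inv_two_pow_natCeil_logb_le {n : ℕ} (hn : 0 < n) :
    (2 : ℝ)⁻¹ ^ ⌈Real.logb 2 n⌉₊ ≤ (n : ℝ)⁻¹ := by
  have hn0 : (0 : ℝ) < n := by exact_mod_cast hn
  rw [inv_pow]
  gcongr
  have := Nat.le_ceil (Real.logb 2 n)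
  rwa [Real.logb_le_iff_le_rpow (by norm_num) hn0, Real.rpow_natCast] at this

theorem norm_toLp_le_of_abs_le {n : ℕ} (hn : 0 < n) {x : Fin n → ℝ} {c : ℝ}
    (hx : ∀ i, |x i| ≤ c / n) : ‖WithLp.toLp 2 x‖ ≤ c / √(n : ℝ) := by
  have hn0 : (0 : ℝ) < n := by exact_mod_cast hn
  have hc : 0 ≤ c / n := (abs_nonneg _).trans (hx ⟨0, hn⟩)
  have hc' : 0 ≤ c := by
    by_contra h
    exact absurd hc (not_le.2 (div_neg_of_neg_of_pos (not_le.1 h) hn0))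
  refine le_of_sq_le_sq ?_ (by positivity)
  rw [EuclideanSpace.real_norm_sq_eq, div_pow, Real.sq_sqrt hn0.le]
  calc ∑ i, x i ^ 2 ≤ ∑ _i : Fin n, (c / n) ^ 2 :=
        Finset.sum_le_sum fun i _ => by rw [← sq_abs]; gcongr; exact hx i
    _ = c ^ 2 / n := by simp; field_simp

/-- The union bound over `2 ^ (k + 1)` vectors with `k ≤ 3 d / 2`: since `8 / 25 < exp (-1)`, the failure
probability `5 ^ (-d)` of each wins. -/
theorem two_pow_mul_inv_five_pow_lt {k d : ℕ} (hd : 0 < d) (hk : 2 * k ≤ 3 * d) :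
    (2 : ℝ) ^ (k + 1) * 5⁻¹ ^ d < 2 * Real.exp (-(d : ℝ) / 2) := by
  have hlt : (2 : ℝ) ^ k * 5⁻¹ ^ d < Real.exp (-(d : ℝ) / 2) := by
    refine lt_of_pow_lt_pow_left₀ 2 (Real.exp_pos _).le ?_
    rw [← Real.exp_nat_mul]
    have he : Real.exp ((2 : ℕ) * (-(d : ℝ) / 2)) = (Real.exp 1)⁻¹ ^ d := by
      rw [← Real.exp_neg, ← Real.exp_nat_mul]
      congr 1
      push_cast
      ring
    rw [he, mul_pow, ← pow_mul, ← pow_mul, mul_comm k, mul_comm d, pow_mul _ 2 d]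
    calc (2 : ℝ) ^ (2 * k) * (5⁻¹ ^ 2) ^ d ≤ 2 ^ (3 * d) * (5⁻¹ ^ 2) ^ d := by
          gcongr
          norm_num
      _ = (8 / 25) ^ d := by rw [pow_mul, ← mul_pow]; norm_num
      _ < _ := by
          refine pow_lt_pow_left₀ ?_ (by norm_num) hd.ne'
          rw [lt_inv_comm₀ (by norm_num) (Real.exp_pos 1)]
          linarith [Real.exp_one_lt_three]
  rw [pow_succ]
  linarith

/-! ### The recovery bound -/

theorem corollary1
    (U : List Bool → List Bool →. List Bool) (hU : IsOptimalPrefixMachine U)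
    (n m d : ℕ) (hn : 2 ≤ n)
    (xo : Fin n → ℝ) (hxo : xo ∈ Set.Icc (0 : Fin n → ℝ) 1)
    (hm : m = ⌈Real.logb 2 n⌉₊)
    (hd : d = ⌈kid U m xo * Real.logb 2 n⌉₊) (hdn : d ≤ n)
    {Ω : Type*} [MeasurableSpace Ω] (P : Measure Ω) [IsProbabilityMeasure P]
    (A : Ω → Matrix (Fin d) (Fin n) ℝ)
    (hA_law : ∀ i j, HasLaw (fun ω => A ω i j) (gaussianReal 0 1) P)
    (hA_indep : iIndepFun (fun (ij : Fin d × Fin n) ω => A ω ij.1 ij.2) P)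
    (xhat : Ω → Fin n → ℝ)
    (hxhat : ∀ᵐ ω ∂P, IsMCPSolution U m (A ω) ((A ω).mulVec xo) (xhat ω)) :
    P.real {ω | ‖WithLp.toLp 2 (xo - xhat ω)‖ > 20 / √(d : ℝ)} < 2 * Real.exp (-(d : ℝ) / 2) := by
  have hn0 : 0 < n := by omega
  have hlog : 0 < Real.logb 2 n :=
    Real.logb_pos (by norm_num) (by exact_mod_cast (by omega : 1 < n))
  have hm0 : 0 < m := by rw [hm]; exact Nat.ceil_pos.2 hlog
  -- For `d = 0` the right-hand side is `2`, and any probability is smaller.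
  rcases Nat.eq_zero_or_pos d with rfl | hd0
  · refine measureReal_le_one.trans_lt ?_
    norm_num
  obtain ⟨k, hk⟩ := ENat.ne_top_iff_exists.1 (resK_ne_top hU hm0 hxo)
  -- `d ≥ (k / m) log₂ n`, and `m ≤ (3 / 2) log₂ n`.
  have hkd : 2 * k ≤ 3 * d := by
    have h1 : (k : ℝ) / m * Real.logb 2 n ≤ d := by
      have := Nat.le_ceil (kid U m xo * Real.logb 2 n)
      rw [← hd] at this
      simpa [kid, ← hk] using this
    have h2 : (m : ℝ) ≤ 3 / 2 * Real.logb 2 n := by rw [hm]; exact natCeil_logb_two_le hn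
    have hm' : (0 : ℝ) < m := by exact_mod_cast hm0
    rw [div_mul_eq_mul_div, div_le_iff₀ hm'] at h1
    have h3 : (k : ℝ) * Real.logb 2 n ≤ (3 / 2 * d) * Real.logb 2 n :=
      h1.trans ((mul_le_mul_of_nonneg_left h2 (Nat.cast_nonneg d)).trans_eq (by ring))
    have h4 := le_of_mul_le_mul_right h3 hlog
    have : (2 * k : ℝ) ≤ 3 * d := by linarith
    exact_mod_cast this
  have hpow : (2 : ℝ)⁻¹ ^ m ≤ (n : ℝ)⁻¹ := by rw [hm]; exact inv_two_pow_natCeil_logb_le hn0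
  obtain ⟨u, hu, -⟩ := exists_program_of_resK_le hk.ge
  obtain ⟨S, hScard, hS⟩ := exists_finset_vectors U (sideInfo n m) hn0 k
  -- `xo - xhat` lies in the kernel of `A`, and within `2 / √n` of `u - s` for some `s ∈ S`.
  let E : (Fin n → ℝ) → Set Ω := fun v => {ω | ∃ z : Fin n → ℝ, (A ω).mulVec z = 0 ∧
    20 / √(d : ℝ) < ‖WithLp.toLp 2 z‖ ∧ ‖WithLp.toLp 2 (z - v)‖ ≤ 2 / √(n : ℝ)}
  have hsub : ∀ᵐ ω ∂P, ω ∈ {ω | ‖WithLp.toLp 2 (xo - xhat ω)‖ > 20 / √(d : ℝ)} →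
      ω ∈ ⋃ s ∈ S, E (u - s) := by
    filter_upwards [hxhat] with ω hω hlarge
    obtain ⟨-, hAx, hmin⟩ := hω
    obtain ⟨s, hs, p, hp, w, hw, hsw⟩ := exists_program_of_resK_le
      ((hmin xo hxo rfl).trans hk.ge)
    refine Set.mem_biUnion (hS s p w hp hw hsw) ⟨xo - xhat ω, ?_, hlarge, ?_⟩
    · rw [Matrix.mulVec_sub, hAx, sub_self]
    · refine norm_toLp_le_of_abs_le hn0 fun i => ?_
      have h1 := (hu i).trans hpow
      have h2 := (hs i).trans hpow
      have : (xo - xhat ω - (u - s)) i = (xo i - u i) - (xhat ω i - s i) := by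
        simp only [Pi.sub_apply]
        ring
      rw [this]
      refine (abs_sub _ _).trans ?_
      rw [div_eq_mul_inv]
      linarith
  have hbound : P {ω | ‖WithLp.toLp 2 (xo - xhat ω)‖ > 20 / √(d : ℝ)}
      ≤ ENNReal.ofReal (2 ^ (k + 1) * 5⁻¹ ^ d) := by
    calc _ ≤ P (⋃ s ∈ S, E (u - s)) := measure_mono_ae hsub
      _ ≤ ∑ s ∈ S, P (E (u - s)) := measure_biUnion_finset_le _ _
      _ ≤ ∑ _s ∈ S, ENNReal.ofReal (5⁻¹ ^ d) :=
          Finset.sum_le_sum fun s _ => measure_kernel_near_le hd0 hdn hA_law hA_indep _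
      _ = S.card * ENNReal.ofReal (5⁻¹ ^ d) := by simp
      _ ≤ (2 ^ (k + 1) : ℕ) * ENNReal.ofReal (5⁻¹ ^ d) := by gcongr
      _ = _ := by
          rw [ENNReal.ofReal_mul (by positivity), ← ENNReal.ofReal_natCast]
          push_cast
          rfl
  exact (ENNReal.toReal_le_of_le_ofReal (by positivity) hbound).trans_lt
    (two_pow_mul_inv_five_pow_lt hd0 hkd)
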